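/- Let $A$ be a (finite or infinite) set of integers, each at least $3$, let $\mathscr{C}_A=\{C_a : a\in A\}$, where $C_a$ is the cycle of length $a$, and let $A_e$ be the set of even elements of $A$. Let $ex(n,C_6,\mathscr{C}_A)$ be the maximum number of copies of $C_6$ (subgraphs isomorphic to $C_6$) in a simple graph on $n$ vertices that contains no member of $\mathscr{C}_A$ as a (not necessarily induced) subgraph. Then, as $n\to\infty$ with $A$ fixed (so the constants implied by $\Theta$ may depend on $A$), $$ex(n,C_6,\mathscr{C}_A)=\begin{cases}0 \text{ (for every } n) & \text{if } 6\in A,\\ \Theta(n^2) & \text{if } 6\notin A,\ 4\in A \text{ and } |A_e|\ge 2,\\ \Theta(n^3) & \text{if } 4,6\notin A \text{ and } A_e\neq\emptyset, \text{ or if } A_e=\{4\},\\ \Theta(n^6) & \text{if } A_e=\emptyset.\end{cases}$$ -/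

import Mathlib

open Filter Asymptotics

namespace GenTuran

/-- A graph `G` is free of a family `𝓕` of finite graphs if it contains no member of `𝓕` as a
(not necessarily induced) subgraph. -/
def FamilyFree {V : Type*} (𝓕 : Set (Σ m : ℕ, SimpleGraph (Fin m))) (G : SimpleGraph V) : Prop :=
  ∀ F ∈ 𝓕, F.2.Free G

open scoped Classical in
/-- The generalized Turán number `ex(n, H, 𝓕)`: the maximum number of copies of `H` (subgraphs
isomorphic to `H`) in an `𝓕`-free graph on `n` vertices. -/
noncomputable def ex {W : Type*} (n : ℕ) (H : SimpleGraph W)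
    (𝓕 : Set (Σ m : ℕ, SimpleGraph (Fin m))) : ℕ :=
  (Finset.univ.filter fun G : SimpleGraph (Fin n) => FamilyFree 𝓕 G).sup fun G => G.copyCount H

/-- The family of cycles `{C_a : a ∈ A}`. -/
def cycleFamily (A : Set ℕ) : Set (Σ m : ℕ, SimpleGraph (Fin m)) :=
  (fun a => ⟨a, SimpleGraph.cycleGraph a⟩) '' A

/-- The set `A_e` of even elements of `A`. -/
def evenPart (A : Set ℕ) : Set ℕ := {a ∈ A | Even a}

end GenTuran

/-! Upper bounds count labelled copies, which exceed copies by at most a constant factor. Let some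
C_{2k} be forbidden. If N(v) and a set Y spanned too many edges, a core of large minimum degree
would contain a path of 2k-2 edges between two neighbours of v, closing to a C_{2k} through v. So
codegrees from v have a linear bound on every Y (`sum_codeg_le`), which bootstraps to ∑ codeg² =
O(n²) (`sum_codeg_sq_le`). A hexagon is three alternate vertices with a common neighbour for each
pair, so Cauchy–Schwarz bounds the count by (∑ codeg²)^{3/2} = O(n³).

If C_4 is also forbidden, a hexagon is instead a pair of 3-edge paths between opposite vertices. The
same argument runs from the second neighbourhood of v, each of whose vertices has a unique parent in
N(v); it gives ∑ `threePaths`² = O(n²).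

Lower bounds come from four constructions: `theta` (every cycle is a hexagon) for n², K_{3,m} (only
4- and 6-cycles) for n³ when 4 is allowed, a bipartite C_4-free point-line incidence graph for n³
when 4 is the only even length forbidden, and K_{m,m} for n⁶. -/

namespace GenTuran

/-! ### Cubic upper bound from one forbidden even cycle. -/

section UpperBound

open scoped Classical

variable {V : Type*}

/-- A dense bipartite relation contains a nonempty part of large minimum degree. -/
theorem exists_core (r : V → V → Prop) (K : ℕ) (X Y : Finset V)
    (h : K * (X.card + Y.card) < ∑ y ∈ Y, (X.filter fun x => r x y).card) :
    ∃ X' ⊆ X, ∃ Y' ⊆ Y, X'.Nonempty ∧ (∀ x ∈ X', K < (Y'.filter fun y => r x y).card) ∧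
      ∀ y ∈ Y', K < (X'.filter fun x => r x y).card := by
  induction hn : X.card + Y.card using Nat.strong_induction_on generalizing X Y with
  | _ n ih =>
  have swap : ∀ X Y : Finset V, ∑ y ∈ Y, (X.filter fun x => r x y).card =
      ∑ x ∈ X, (Y.filter fun y => r x y).card := fun X Y =>
    (Finset.sum_card_bipartiteAbove_eq_sum_card_bipartiteBelow r (s := X) (t := Y)).symm
  -- Deleting a vertex of degree at most K lowers the edge count by at most K and the threshold by
  -- exactly K, so density survives.
  by_cases hx : ∃ x ∈ X, (Y.filter fun y => r x y).card ≤ K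
  · obtain ⟨x, hxX, hxK⟩ := hx
    have hc := Finset.card_erase_add_one hxX
    rw [swap, ← Finset.add_sum_erase _ _ hxX, ← hc] at h
    obtain ⟨X', hX', Y', hY', H⟩ := ih ((X.erase x).card + Y.card) (by omega) (X.erase x) Y
      (by rw [swap]; nlinarith) rfl
    exact ⟨X', hX'.trans (Finset.erase_subset _ _), Y', hY', H⟩
  by_cases hy : ∃ y ∈ Y, (X.filter fun x => r x y).card ≤ K
  · obtain ⟨y, hyY, hyK⟩ := hy
    have hc := Finset.card_erase_add_one hyY
    rw [← Finset.add_sum_erase _ _ hyY, ← hc] at h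
    obtain ⟨X', hX', Y', hY', H⟩ := ih (X.card + (Y.erase y).card) (by omega) X (Y.erase y)
      (by nlinarith) rfl
    exact ⟨X', hX', Y', hY'.trans (Finset.erase_subset _ _), H⟩
  push Not at hx hy
  refine ⟨X, subset_rfl, Y, subset_rfl, ?_, hx, hy⟩
  rw [Finset.nonempty_iff_ne_empty]
  rintro rfl
  simp at h

theorem exists_avoiding (π : V → V) (A F : Finset V) (hπ : Set.InjOn π A)
    (h : 2 * F.card < A.card) : ∃ x ∈ A, x ∉ F ∧ π x ∉ F := by
  by_contra! hc
  have h1 : A ⊆ F ∪ A.filter fun x => π x ∈ F := by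
    intro x hx
    by_cases hF : x ∈ F
    · simp [hF]
    · simp [hx, hc x hx hF]
  have h2 : (A.filter fun x => π x ∈ F).card ≤ F.card :=
    Finset.card_le_card_of_injOn π (by intro x; simp) (hπ.mono (Finset.coe_subset.2 (Finset.filter_subset _ _)))
  have := (Finset.card_le_card h1).trans (Finset.card_union_le _ _)
  omega

/-- Greedy construction of a path alternating between two sets of large minimum degree. The path
avoids `S`, and the parent `π b` of its last vertex `b` avoids `S` and the rest of the path. -/
theorem exists_alternating_path (G : SimpleGraph V) (r : V → V → Prop) (π : V → V) (K : ℕ)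
    (X Y S : Finset V) (hr : ∀ x ∈ X, ∀ y ∈ Y, r x y → G.Adj x y)
    (hπ : ∀ y ∈ Y, Set.InjOn π {x | x ∈ X ∧ r x y})
    (hX : ∀ x ∈ X, K < (Y.filter fun y => r x y).card)
    (hY : ∀ y ∈ Y, K < (X.filter fun x => r x y).card)
    (b₁ : V) (hb₁ : b₁ ∈ X) (hb₁S : b₁ ∉ S) (j : ℕ) (hj : 2 * (S.card + 2 * j + 1) ≤ K) :
    ∃ b ∈ X, ∃ p : G.Walk b b₁, p.IsPath ∧ p.length = 2 * j ∧ (∀ s ∈ p.support, s ∉ S) ∧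
      (0 < j → π b ∉ S ∧ ∀ s ∈ p.support, s ≠ b → π b ≠ s) := by
  induction j with
  | zero => exact ⟨b₁, hb₁, .nil, by simp, by simp, by simpa using hb₁S, by simp⟩
  | succ j ih =>
    obtain ⟨b, hb, p, hp, hl, hS, -⟩ := ih (by omega)
    have hF : (S ∪ p.support.toFinset).card ≤ S.card + (2 * j + 1) := by
      refine (Finset.card_union_le _ _).trans ?_
      have := p.support.toFinset_card_le
      rw [p.length_support] at this
      omega
    obtain ⟨w, hw, hwF⟩ : ∃ w ∈ Y.filter fun y => r b y, w ∉ S ∪ p.support.toFinset := by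
      apply Finset.exists_mem_notMem_of_card_lt_card
      have := hX b hb
      omega
    obtain ⟨hwY, hbw⟩ := Finset.mem_filter.1 hw
    have hF' := Finset.card_insert_le w (S ∪ p.support.toFinset)
    -- Each forbidden vertex excludes at most two candidates, itself and the one whose parent it is;
    -- hence the factor 2 in `hj`.
    obtain ⟨b', hb', hbF, hπF⟩ := exists_avoiding π (X.filter fun x => r x w)
      (insert w (S ∪ p.support.toFinset)) (by simpa using hπ w hwY)
      (by have := hY w hwY; omega)
    obtain ⟨hb'X, hb'w⟩ := Finset.mem_filter.1 hb'
    simp only [Finset.mem_insert, Finset.mem_union, List.mem_toFinset, not_or] at hwF hbF hπF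
    refine ⟨b', hb'X, .cons (hr b' hb'X w hwY hb'w) (.cons (hr b hb w hwY hbw).symm p),
      ?_, ?_, ?_, fun _ => ⟨hπF.2.1, ?_⟩⟩
    · simp [SimpleGraph.Walk.cons_isPath_iff, hp, hwF.2, hbF.1, hbF.2.2]
    · simp [hl]; ring
    · simp only [SimpleGraph.Walk.support_cons, List.mem_cons]
      rintro s (rfl | rfl | hs)
      exacts [hbF.2.1, hwF.1, hS s hs]
    · simp only [SimpleGraph.Walk.support_cons, List.mem_cons]
      rintro s (rfl | rfl | hs) hsb
      · exact absurd rfl hsb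
      · exact hπF.1
      · rintro rfl; exact hπF.2.2 hs

/-- A relation with a linear bound on every `Y' ⊆ Y` has a good bound on its sum of squares. -/
theorem sum_sq_le_of_sum_le (Y : Finset V) (f : V → ℕ) (K N M : ℕ) (hM : ∀ y ∈ Y, f y ≤ M)
    (h : ∀ Y' ⊆ Y, ∑ y ∈ Y', f y ≤ K * (N + Y'.card)) :
    ∑ y ∈ Y, f y ^ 2 ≤ 4 * K ^ 2 * Y.card + 2 * K * N * M := by
  -- Above the threshold 2K, the term K|Z| is at most half of the sum over Z and can be absorbed.
  set Z := Y.filter fun y => 2 * K < f y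
  have h1 : ∑ y ∈ Z, f y ≤ 2 * K * N := by
    have a := h Z (Finset.filter_subset _ _)
    have b : Z.card * (2 * K) ≤ ∑ y ∈ Z, f y := by
      rw [← smul_eq_mul]
      exact Finset.card_nsmul_le_sum _ _ _ fun y hy => (Finset.mem_filter.1 hy).2.le
    nlinarith
  have h2 : ∑ y ∈ Z, f y ^ 2 ≤ 2 * K * N * M := by
    calc ∑ y ∈ Z, f y ^ 2 ≤ ∑ y ∈ Z, f y * M := Finset.sum_le_sum fun y hy => by
          rw [sq]; exact Nat.mul_le_mul_left _ (hM y (Finset.filter_subset _ _ hy))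
      _ = (∑ y ∈ Z, f y) * M := (Finset.sum_mul ..).symm
      _ ≤ _ := Nat.mul_le_mul_right _ h1
  have h3 : ∑ y ∈ Y.filter (fun y => ¬ 2 * K < f y), f y ^ 2 ≤ 4 * K ^ 2 * Y.card := by
    refine (Finset.sum_le_card_nsmul _ _ (4 * K ^ 2) fun y hy => ?_).trans ?_
    · have := (Finset.mem_filter.1 hy).2
      nlinarith
    · rw [smul_eq_mul, mul_comm]
      exact Nat.mul_le_mul_left _ (Finset.card_filter_le _ _)
  rw [← Finset.sum_filter_add_sum_filter_not Y (fun y => 2 * K < f y), add_comm]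
  exact add_le_add h3 h2

/-- A path with both ends adjacent to an outside vertex closes up to a cycle. -/
theorem cycleGraph_isContained_of_path (G : SimpleGraph V) {v a b : V} (p : G.Walk a b)
    (hp : p.IsPath) (hl : 0 < p.length) (hv : v ∉ p.support) (ha : G.Adj v a) (hb : G.Adj b v) :
    (SimpleGraph.cycleGraph (p.length + 2)).IsContained G := by
  rw [SimpleGraph.cycleGraph_isContained_iff (by omega)]
  refine ⟨v, .cons ha (p.concat hb), ?_, by simp⟩
  rw [SimpleGraph.Walk.cons_isCycle_iff]
  refine ⟨hp.concat hv hb, ?_⟩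
  rw [SimpleGraph.Walk.edges_concat]
  simp only [List.concat_eq_append, List.mem_append, List.mem_singleton, not_or]
  refine ⟨fun h => hv (p.fst_mem_support_of_mem_edges h), fun h => ?_⟩
  have hab : a = b := by
    rcases Sym2.eq_iff.1 h with ⟨h1, -⟩ | ⟨-, h2⟩
    · exact absurd h1 hb.ne'
    · exact h2
  subst hab
  rw [SimpleGraph.Walk.isPath_iff_nil, ← SimpleGraph.Walk.length_eq_zero_iff] at hp
  omega

variable [Fintype V] (G : SimpleGraph V)

/-- The number of common neighbours of two vertices. -/
noncomputable def codeg (v w : V) : ℕ := ((G.neighborFinset v).filter fun x => G.Adj x w).card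

/-- Otherwise a core inside N(v) × Y carries a path of 2(k-1) edges that avoids v and has both ends
in N(v). The degree 4k is exactly what the greedy path needs with one forbidden vertex. -/
theorem sum_codeg_le {k : ℕ} (hk : 2 ≤ k) (hG : (SimpleGraph.cycleGraph (2 * k)).Free G)
    (v : V) (Y : Finset V) :
    ∑ y ∈ Y, codeg G v y ≤ 4 * k * (G.degree v + Y.card) := by
  by_contra! hc
  obtain ⟨X', hX', Y', hY', ⟨b₁, hb₁⟩, hX, hYd⟩ :=
    exists_core G.Adj (4 * k) (G.neighborFinset v) Y hc
  have hb₁v := (G.mem_neighborFinset _ _).1 (hX' hb₁)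
  obtain ⟨b, hb, p, hp, hl, hS, -⟩ := exists_alternating_path G G.Adj id (4 * k) X' Y' {v}
    (fun _ _ _ _ h => h) (fun _ _ => Function.injective_id.injOn) hX hYd b₁ hb₁
    (by simpa using hb₁v.ne') (k - 1) (by simp; omega)
  have := cycleGraph_isContained_of_path G p hp (by omega) (fun h => by simpa using hS v h)
    ((G.mem_neighborFinset _ _).1 (hX' hb)) hb₁v.symm
  rw [hl, show 2 * (k - 1) + 2 = 2 * k by omega] at this
  exact hG this

/-- Two-edge walks counted by midpoint and by endpoints. -/
theorem sum_degree_sq : ∑ v, G.degree v ^ 2 = ∑ v, ∑ w, codeg G v w := by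
  have h1 : ∀ v w, codeg G v w = ∑ u, if G.Adj u v ∧ G.Adj u w then 1 else 0 := by
    intro v w
    rw [codeg, Finset.card_eq_sum_ones, Finset.sum_filter, ← Finset.sum_filter_add_sum_filter_not
      Finset.univ (fun u => G.Adj u v)]
    rw [← Finset.card_filter, Finset.sum_eq_zero (s := Finset.univ.filter fun u => ¬ G.Adj u v)]
    · rw [← Finset.card_filter, add_zero]
      congr 1
      ext u
      simp [G.adj_comm]
    · simp +contextual
  simp_rw [h1]
  rw [Finset.sum_congr rfl fun v _ => Finset.sum_comm, Finset.sum_comm]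
  refine Finset.sum_congr rfl fun u _ => ?_
  have h2 : ∀ v w, (if G.Adj u v ∧ G.Adj u w then 1 else 0) =
      (if G.Adj u v then 1 else 0) * (if G.Adj u w then 1 else 0) := by
    intro v w; by_cases h : G.Adj u v <;> by_cases h' : G.Adj u w <;> simp [h, h']
  simp_rw [h2]
  rw [← Finset.sum_mul_sum, ← Finset.card_filter, sq, ← G.card_neighborFinset_eq_degree,
    G.neighborFinset_eq_filter]

theorem codeg_le_degree (v w : V) : codeg G v w ≤ G.degree v := by
  rw [← G.card_neighborFinset_eq_degree]
  exact Finset.card_filter_le _ _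

/-- A `C_{2k}`-free graph has a quadratic sum of squares of codegrees, i.e. `O(n²)` copies of
`C_4`. -/
theorem sum_codeg_sq_le {k : ℕ} (hk : 2 ≤ k) (hG : (SimpleGraph.cycleGraph (2 * k)).Free G) :
    ∑ v, ∑ w, codeg G v w ^ 2 ≤ 128 * k ^ 2 * Fintype.card V ^ 2 := by
  set n := Fintype.card V
  have hd : ∀ v, G.degree v ≤ n := fun v => (G.degree_lt_card_verts v).le
  have h1 : ∀ v, ∑ w, codeg G v w ^ 2 ≤ 64 * k ^ 2 * n + 8 * k * G.degree v ^ 2 := by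
    intro v
    have := sum_sq_le_of_sum_le Finset.univ (codeg G v) (4 * k) (G.degree v) (G.degree v)
      (fun y _ => codeg_le_degree G v y) (fun Y' _ => sum_codeg_le G hk hG v Y')
    rw [Finset.card_univ] at this
    nlinarith
  have h2 : ∑ v, G.degree v ^ 2 ≤ 8 * k * n ^ 2 := by
    rw [sum_degree_sq]
    have : ∀ v ∈ Finset.univ, ∑ w, codeg G v w ≤ 8 * k * n := by
      intro v _
      have := sum_codeg_le G hk hG v Finset.univ
      have := Nat.mul_le_mul_left (4 * k) (hd v)
      rw [Finset.card_univ] at *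
      nlinarith
    refine (Finset.sum_le_card_nsmul _ _ _ this).trans_eq ?_
    rw [smul_eq_mul, Finset.card_univ]
    ring
  calc _ ≤ ∑ v, (64 * k ^ 2 * n + 8 * k * G.degree v ^ 2) := Finset.sum_le_sum fun v _ => h1 v
    _ = 64 * k ^ 2 * n * n + 8 * k * ∑ v, G.degree v ^ 2 := by
      rw [Finset.sum_add_distrib, Finset.mul_sum, Finset.sum_const, Finset.card_univ, smul_eq_mul,
        mul_comm n]
    _ ≤ 64 * k ^ 2 * n * n + 8 * k * (8 * k * n ^ 2) := by gcongr
    _ = _ := by ring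

/-- The trace of the cube of a symmetric kernel is controlled by its Hilbert–Schmidt norm. -/
theorem sq_sum_triple_le (D : V → V → ℕ) :
    (∑ x, ∑ y, D x y * ∑ z, D y z * D z x) ^ 2 ≤ (∑ x, ∑ y, D x y ^ 2) ^ 3 := by
  calc (∑ x, ∑ y, D x y * ∑ z, D y z * D z x) ^ 2
      = (∑ q : V × V, D q.1 q.2 * ∑ z, D q.2 z * D z q.1) ^ 2 := by
        rw [← Finset.univ_product_univ, Finset.sum_product]
    _ ≤ (∑ q : V × V, D q.1 q.2 ^ 2) * ∑ q : V × V, (∑ z, D q.2 z * D z q.1) ^ 2 :=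
        Finset.sum_mul_sq_le_sq_mul_sq _ _ _
    _ ≤ (∑ q : V × V, D q.1 q.2 ^ 2) *
          ∑ q : V × V, (∑ z, D q.2 z ^ 2) * ∑ z, D z q.1 ^ 2 := by
        gcongr
        exact Finset.sum_mul_sq_le_sq_mul_sq _ _ _
    _ = _ := by
        rw [← Finset.univ_product_univ, Finset.sum_product, Finset.sum_product]
        simp_rw [← Finset.sum_mul, ← Finset.mul_sum]
        rw [Finset.sum_comm (f := fun x z => D z x ^ 2)]
        ring

theorem labelledCopyCount_le_card {W β : Type*} [Fintype W] {H : SimpleGraph W} (T : Finset β)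
    (F : H.Copy G → β) (hT : ∀ f, F f ∈ T) (hF : Function.Injective F) :
    G.labelledCopyCount H ≤ T.card := by
  unfold SimpleGraph.labelledCopyCount
  rw [← Fintype.card_coe T]
  exact Fintype.card_le_of_injective (fun f => ⟨F f, hT f⟩) fun f g h =>
    hF (congrArg Subtype.val h)

/-- Vertices 0, 2, 4 of the hexagon play x, y, z; vertices 1, 3, 5 are common neighbours of
consecutive pairs. -/
theorem labelledCopyCount_cycleGraph_six_le_sum_codeg :
    G.labelledCopyCount (SimpleGraph.cycleGraph 6) ≤
      ∑ x, ∑ y, codeg G x y * ∑ z, codeg G y z * codeg G z x := by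
  have h : ∑ x, ∑ y, codeg G x y * ∑ z, codeg G y z * codeg G z x =
      (Finset.univ.sigma fun q : V × V × V =>
        ((G.neighborFinset q.1).filter fun x => G.Adj x q.2.1) ×ˢ
        ((G.neighborFinset q.2.1).filter fun x => G.Adj x q.2.2) ×ˢ
        ((G.neighborFinset q.2.2).filter fun x => G.Adj x q.1)).card := by
    simp_rw [Finset.card_sigma, Finset.card_product, Finset.mul_sum, codeg]
    rw [← Finset.univ_product_univ, Finset.sum_product, ← Finset.univ_product_univ]
    simp_rw [Finset.sum_product]
  rw [h]
  refine labelledCopyCount_le_card G _ (fun f : (SimpleGraph.cycleGraph 6).Copy G =>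
    (⟨(f 0, f 2, f 4), (f 1, f 3, f 5)⟩ : Σ _ : V × V × V, V × V × V)) ?_ ?_
  · intro f
    have h {i j : Fin 6} (hij : (SimpleGraph.cycleGraph 6).Adj i j) : G.Adj (f i) (f j) :=
      f.toHom.map_adj hij
    simp only [Finset.mem_sigma, Finset.mem_univ, true_and, Finset.mem_product,
      Finset.mem_filter, SimpleGraph.mem_neighborFinset]
    exact ⟨⟨h (by decide), h (by decide)⟩, ⟨h (by decide), h (by decide)⟩,
      ⟨h (by decide), h (by decide)⟩⟩
  · intro f g hfg
    simp only [Sigma.mk.injEq, Prod.mk.injEq, heq_eq_eq] at hfg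
    ext i
    fin_cases i <;> simp [hfg]

/-- A `C_{2k}`-free graph has `O(n³)` labelled copies of `C_6`. -/
theorem labelledCopyCount_cycleGraph_six_le_cube {k : ℕ} (hk : 2 ≤ k)
    (hG : (SimpleGraph.cycleGraph (2 * k)).Free G) :
    G.labelledCopyCount (SimpleGraph.cycleGraph 6) ≤ (128 * k ^ 2) ^ 2 * Fintype.card V ^ 3 := by
  refine (labelledCopyCount_cycleGraph_six_le_sum_codeg G).trans ?_
  rw [← Nat.pow_le_pow_iff_left (two_ne_zero)]
  refine (sq_sum_triple_le (codeg G)).trans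
    ((Nat.pow_le_pow_left (sum_codeg_sq_le G hk hG) 3).trans ?_)
  calc (128 * k ^ 2 * Fintype.card V ^ 2) ^ 3
      = (128 * k ^ 2) ^ 3 * Fintype.card V ^ 6 := by ring
    -- The exponent 3 is rounded up to 4 to make the bound a perfect square.
    _ ≤ (128 * k ^ 2) ^ 4 * Fintype.card V ^ 6 := by
      gcongr
      · nlinarith
      · norm_num
    _ = _ := by ring

end UpperBound

/-! ### Quadratic upper bound when C_4 and a longer even cycle are forbidden. -/

section UpperBoundC4Free

open scoped Classical

variable {V : Type*} (G : SimpleGraph V)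

theorem eq_of_common_neighbors {G : SimpleGraph V} (h4 : (SimpleGraph.cycleGraph 4).Free G)
    {u w x y : V} (huw : u ≠ w) (hux : G.Adj u x) (hwx : G.Adj w x) (huy : G.Adj u y)
    (hwy : G.Adj w y) : x = y := by
  by_contra hxy
  exact h4 (cycleGraph_isContained_of_path G (.cons hux.symm (.cons huy .nil))
    (by simp [SimpleGraph.Walk.cons_isPath_iff, hux.ne', hxy, huy.ne])
    (by simp) (by simp [huw.symm, hwx.ne, hwy.ne]) hwx hwy.symm)

/-- A common neighbour of `v` and `b`, if there is one. -/
noncomputable def parent (v b : V) : V :=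
  -- The default is arbitrary: the lemmas about parents concern only vertices with a common
  -- neighbour.
  if h : ∃ a, G.Adj v a ∧ G.Adj a b then h.choose else b

theorem parent_eq {G : SimpleGraph V} (h4 : (SimpleGraph.cycleGraph 4).Free G) {v a b : V}
    (hb : b ≠ v) (hva : G.Adj v a) (hab : G.Adj a b) : parent G v b = a := by
  have h : ∃ a, G.Adj v a ∧ G.Adj a b := ⟨a, hva, hab⟩
  rw [parent, dif_pos h]
  exact eq_of_common_neighbors h4 hb.symm h.choose_spec.1 h.choose_spec.2.symm hva hab.symm

/-- `b w` continues the path `v, parent v b, b`. -/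
def Extends (v b w : V) : Prop := G.Adj b w ∧ parent G v b ≠ w

variable [Fintype V]

/-- The vertices joined to `v` by a path with two edges. -/
noncomputable def secondNbhd (v : V) : Finset V :=
  Finset.univ.filter fun b => b ≠ v ∧ ∃ a, G.Adj v a ∧ G.Adj a b

variable {G} in
theorem mem_secondNbhd {v b : V} :
    b ∈ secondNbhd G v ↔ b ≠ v ∧ ∃ a, G.Adj v a ∧ G.Adj a b := by
  simp [secondNbhd]

variable {G} in
theorem parent_spec {v b : V} (hb : b ∈ secondNbhd G v) :
    G.Adj v (parent G v b) ∧ G.Adj (parent G v b) b := by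
  rw [parent, dif_pos (mem_secondNbhd.1 hb).2]
  exact (mem_secondNbhd.1 hb).2.choose_spec

/-- The number of walks `v, a, b, w` with `v ≠ b` and `a ≠ w`, in a `C_4`-free graph. -/
noncomputable def threePaths (v w : V) : ℕ :=
  ((secondNbhd G v).filter fun b => Extends G v b w).card

variable {G}

/-- Two such vertices with the same parent would form a C_4 with that parent and w. This lets the
greedy path keep the last parent fresh. -/
theorem parent_injOn (h4 : (SimpleGraph.cycleGraph 4).Free G) (v w : V) :
    Set.InjOn (parent G v) {b | b ∈ secondNbhd G v ∧ Extends G v b w} := by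
  rintro b ⟨hb, hbw, hp⟩ b' ⟨hb', hbw', -⟩ h
  exact eq_of_common_neighbors h4 hp (parent_spec hb).2 hbw.symm (h ▸ (parent_spec hb').2)
    hbw'.symm

theorem threePaths_le_degree (h4 : (SimpleGraph.cycleGraph 4).Free G) (v w : V) :
    threePaths G v w ≤ G.degree v := by
  rw [← G.card_neighborFinset_eq_degree]
  refine Finset.card_le_card_of_injOn (parent G v) ?_ (by simpa using parent_injOn h4 v w)
  intro b hb
  simpa using (parent_spec (Finset.mem_filter.1 hb).1).1

/-- Otherwise a core yields a path of 2(k-2) edges between second neighbours b and b₁ of v with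
distinct parents; the four edges through the parents and v complete a C_{2k}. -/
theorem sum_threePaths_le (h4 : (SimpleGraph.cycleGraph 4).Free G) {k : ℕ} (hk : 3 ≤ k)
    (hG : (SimpleGraph.cycleGraph (2 * k)).Free G) (v : V) (Y : Finset V) :
    ∑ y ∈ Y, threePaths G v y ≤ 4 * k * ((secondNbhd G v).card + Y.card) := by
  by_contra! hc
  obtain ⟨X', hX', Y', hY', ⟨b₁, hb₁⟩, hX, hYd⟩ :=
    exists_core (Extends G v) (4 * k) (secondNbhd G v) Y hc
  obtain ⟨hva₁, hab₁⟩ := parent_spec (hX' hb₁)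
  obtain ⟨b, hb, p, hp, hl, hS, hπ⟩ := exists_alternating_path G (Extends G v) (parent G v) (4 * k)
    X' Y' {v, parent G v b₁} (fun _ _ _ _ h => h.1)
    (fun y _ => Set.InjOn.mono (fun x (hx : x ∈ X' ∧ Extends G v x y) =>
      (⟨hX' hx.1, hx.2⟩ : x ∈ secondNbhd G v ∧ _)) (parent_injOn h4 v y)) hX hYd b₁ hb₁
    (by simpa using ⟨(mem_secondNbhd.1 (hX' hb₁)).1, hab₁.ne'⟩) (k - 2)
    (by have := Finset.card_le_two (a := v) (b := parent G v b₁); omega)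
  obtain ⟨hva, hab⟩ := parent_spec (hX' hb)
  -- Here k ≥ 3 is needed: a trivial path would have b = b₁ and a single parent.
  obtain ⟨hπS, hπp⟩ := hπ (by omega)
  simp only [Finset.mem_insert, Finset.mem_singleton, not_or] at hS hπS
  have hap : parent G v b ∉ p.support := fun h => hπp _ h hab.ne rfl
  set q : G.Walk (parent G v b) (parent G v b₁) := .cons hab (p.concat hab₁.symm) with hq
  have hqp : q.IsPath := by
    rw [hq, SimpleGraph.Walk.cons_isPath_iff]
    refine ⟨hp.concat (fun h => (hS _ h).2 rfl) _, ?_⟩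
    simpa [SimpleGraph.Walk.support_concat] using ⟨hap, hπS.2⟩
  have hql : q.length + 2 = 2 * k := by
    simp only [hq, SimpleGraph.Walk.length_cons, SimpleGraph.Walk.length_concat, hl]
    omega
  have := cycleGraph_isContained_of_path G q hqp (by omega) (v := v)
    (by simpa [hq, SimpleGraph.Walk.support_concat] using
      ⟨hva.ne, fun h => (hS _ h).1 rfl, hva₁.ne⟩) hva hva₁.symm
  rw [hql] at this
  exact hG this

/-- A neighbour u of v and a second neighbour b with parent a give the path u, v, a, b, counted from
u to b, unless u = a; in that case (v, b) determines u. -/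
theorem sum_degree_mul_secondNbhd_le (h4 : (SimpleGraph.cycleGraph 4).Free G) :
    ∑ v, G.degree v * (secondNbhd G v).card ≤
      ∑ v, ∑ w, threePaths G v w + Fintype.card V ^ 2 := by
  set T : Finset (Σ _ : V, V × V) :=
    Finset.univ.sigma fun v => G.neighborFinset v ×ˢ secondNbhd G v
  have hT : ∑ v, G.degree v * (secondNbhd G v).card = T.card := by
    simp_rw [T, Finset.card_sigma, Finset.card_product, G.card_neighborFinset_eq_degree]
  have memT : ∀ t : (Σ _ : V, V × V), t ∈ T ↔ G.Adj t.1 t.2.1 ∧ t.2.2 ∈ secondNbhd G t.1 := by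
    intro t; simp [T]
  have h1 : (T.filter fun t => ¬ t.2.1 = parent G t.1 t.2.2).card ≤
      ∑ v, ∑ w, threePaths G v w := by
    have : ∑ v, ∑ w, threePaths G v w = (Finset.univ.sigma fun q : V × V =>
        (secondNbhd G q.1).filter fun b => Extends G q.1 b q.2).card := by
      rw [Finset.card_sigma, ← Finset.univ_product_univ, Finset.sum_product]
      rfl
    rw [this]
    -- Seen from u, the parent of a is v, so v can be recovered and the map below is injective.
    have key : ∀ t ∈ T.filter fun t => ¬ t.2.1 = parent G t.1 t.2.2,
        parent G t.2.1 (parent G t.1 t.2.2) = t.1 := by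
      intro t ht
      rw [Finset.mem_filter, memT] at ht
      exact parent_eq h4 (Ne.symm ht.2) ht.1.1.symm (parent_spec ht.1.2).1
    refine Finset.card_le_card_of_injOn (fun t : (Σ _ : V, V × V) =>
      (⟨(t.2.1, t.2.2), parent G t.1 t.2.2⟩ : Σ _ : V × V, V)) ?_ ?_
    · intro t ht
      have k := key t ht
      rw [Finset.mem_coe, Finset.mem_filter, memT] at ht
      obtain ⟨⟨hvu, hb⟩, hne⟩ := ht
      obtain ⟨hva, hab⟩ := parent_spec hb
      simp only [Finset.mem_coe, Finset.mem_sigma, Finset.mem_univ, true_and, Finset.mem_filter]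
      refine ⟨mem_secondNbhd.2 ⟨Ne.symm hne, t.1, hvu.symm, hva⟩, hab, ?_⟩
      rw [k]
      exact (mem_secondNbhd.1 hb).1.symm
    · rintro t ht t' ht' h
      have k := key t ht
      have k' := key t' ht'
      simp only [Sigma.mk.injEq, Prod.mk.injEq, heq_eq_eq] at h
      rw [h.1.1, h.2, k'] at k
      exact Sigma.ext k.symm (heq_of_eq (Prod.ext h.1.1 h.1.2))
  have h2 : (T.filter fun t => t.2.1 = parent G t.1 t.2.2).card ≤ Fintype.card V ^ 2 := by
    rw [sq, ← Fintype.card_prod, ← Finset.card_univ]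
    refine Finset.card_le_card_of_injOn (fun t => (t.1, t.2.2)) (by simp) ?_
    rintro ⟨v, u, b⟩ ht ⟨v', u', b'⟩ ht' h
    simp only [Prod.mk.injEq] at h
    obtain ⟨rfl, rfl⟩ := h
    rw [Finset.mem_coe, Finset.mem_filter] at ht ht'
    simp only at ht ht'
    rw [ht.2, ht'.2]
  rw [hT, ← Finset.card_filter_add_card_filter_not (fun t => t.2.1 = parent G t.1 t.2.2)]
  omega

theorem sum_threePaths_sq_le (h4 : (SimpleGraph.cycleGraph 4).Free G) {k : ℕ} (hk : 3 ≤ k)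
    (hG : (SimpleGraph.cycleGraph (2 * k)).Free G) :
    ∑ v, ∑ w, threePaths G v w ^ 2 ≤ 136 * k ^ 2 * Fintype.card V ^ 2 := by
  set n := Fintype.card V
  have h1 : ∀ v, ∑ w, threePaths G v w ^ 2 ≤
      64 * k ^ 2 * n + 8 * k * (G.degree v * (secondNbhd G v).card) := by
    intro v
    have := sum_sq_le_of_sum_le Finset.univ (threePaths G v) (4 * k) (secondNbhd G v).card
      (G.degree v) (fun y _ => threePaths_le_degree h4 v y)
      (fun Y' _ => sum_threePaths_le h4 hk hG v Y')
    rw [Finset.card_univ] at this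
    refine this.trans_eq ?_
    ring
  have h2 : ∑ v, ∑ w, threePaths G v w ≤ 8 * k * n ^ 2 := by
    have : ∀ v ∈ Finset.univ, ∑ w, threePaths G v w ≤ 8 * k * n := by
      intro v _
      have h := sum_threePaths_le h4 hk hG v Finset.univ
      have := Nat.mul_le_mul_left (4 * k) (Finset.card_le_univ (secondNbhd G v))
      rw [Finset.card_univ] at h
      nlinarith
    refine (Finset.sum_le_card_nsmul _ _ _ this).trans_eq ?_
    rw [smul_eq_mul, Finset.card_univ]
    ring
  calc _ ≤ ∑ v, (64 * k ^ 2 * n + 8 * k * (G.degree v * (secondNbhd G v).card)) :=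
        Finset.sum_le_sum fun v _ => h1 v
    _ = 64 * k ^ 2 * n * n + 8 * k * ∑ v, G.degree v * (secondNbhd G v).card := by
      rw [Finset.sum_add_distrib, Finset.mul_sum, Finset.sum_const, Finset.card_univ, smul_eq_mul,
        mul_comm n]
    _ ≤ 64 * k ^ 2 * n * n + 8 * k * (8 * k * n ^ 2 + n ^ 2) := by
      gcongr
      exact (sum_degree_mul_secondNbhd_le h4).trans (by gcongr)
    _ ≤ _ := by
      have : k * n ^ 2 ≤ k ^ 2 * n ^ 2 := by gcongr; nlinarith
      nlinarith

/-- A graph without `C_4` and `C_{2k}`, `k ≥ 3`, has `O(n²)` labelled copies of `C_6`. -/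
theorem labelledCopyCount_cycleGraph_six_le_sq (h4 : (SimpleGraph.cycleGraph 4).Free G) {k : ℕ}
    (hk : 3 ≤ k) (hG : (SimpleGraph.cycleGraph (2 * k)).Free G) :
    G.labelledCopyCount (SimpleGraph.cycleGraph 6) ≤ 136 * k ^ 2 * Fintype.card V ^ 2 := by
  refine le_trans ?_ (sum_threePaths_sq_le h4 hk hG)
  have h : ∑ v, ∑ w, threePaths G v w ^ 2 =
      (Finset.univ.sigma fun q : V × V =>
        ((secondNbhd G q.1).filter fun b => Extends G q.1 b q.2) ×ˢ
        ((secondNbhd G q.1).filter fun b => Extends G q.1 b q.2)).card := by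
    rw [Finset.card_sigma, ← Finset.univ_product_univ, Finset.sum_product]
    simp_rw [Finset.card_product, sq]
    rfl
  rw [h]
  have adj {f : (SimpleGraph.cycleGraph 6).Copy G} {i j : Fin 6}
    (hij : (SimpleGraph.cycleGraph 6).Adj i j) : G.Adj (f i) (f j) := f.toHom.map_adj hij
  have ne {f : (SimpleGraph.cycleGraph 6).Copy G} {i j : Fin 6} (hij : i ≠ j) : f i ≠ f j :=
    fun h => hij (f.injective h)
  have p2 (f : (SimpleGraph.cycleGraph 6).Copy G) : parent G (f 0) (f 2) = f 1 :=
    parent_eq h4 (ne (by decide)) (adj (by decide)) (adj (by decide))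
  have p4 (f : (SimpleGraph.cycleGraph 6).Copy G) : parent G (f 0) (f 4) = f 5 :=
    parent_eq h4 (ne (by decide)) (adj (by decide)) (adj (by decide))
  refine labelledCopyCount_le_card G _ (fun f : (SimpleGraph.cycleGraph 6).Copy G =>
    (⟨(f 0, f 3), (f 2, f 4)⟩ : Σ _ : V × V, V × V)) ?_ ?_
  · intro f
    simp only [Finset.mem_sigma, Finset.mem_univ, true_and, Finset.mem_product,
      Finset.mem_filter]
    simp only [mem_secondNbhd, Extends, p2, p4]
    exact ⟨⟨⟨ne (by decide), f 1, adj (by decide), adj (by decide)⟩, adj (by decide),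
      ne (by decide)⟩, ⟨ne (by decide), f 5, adj (by decide), adj (by decide)⟩,
      adj (by decide), ne (by decide)⟩
  · intro f g hfg
    simp only [Sigma.mk.injEq, Prod.mk.injEq, heq_eq_eq] at hfg
    have h1 := p2 f
    have h5 := p4 f
    rw [hfg.1.1, hfg.2.1, p2] at h1
    rw [hfg.1.1, hfg.2.2, p4] at h5
    ext i
    fin_cases i <;> simp [hfg, h1, h5]

end UpperBoundC4Free

/-! ### Labelled versus unlabelled copies, and tools for building hexagons. -/

section Counting

/-- Labelled copies with the same image as g differ from g by a self-map of W; all self-maps are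
allowed, since only a constant is needed. -/
theorem labelledCopyCount_le_mul_copyCount {V W : Type*} [Fintype V] [Fintype W]
    (G : SimpleGraph V) (H : SimpleGraph W) :
    G.labelledCopyCount H ≤ Fintype.card W ^ Fintype.card W * G.copyCount H := by
  classical
  rw [SimpleGraph.copyCount_eq_card_image_copyToSubgraph, SimpleGraph.labelledCopyCount]
  refine le_trans (le_of_eq ?_) (Finset.card_le_mul_card_image Finset.univ _ ?_)
  · rw [Finset.card_univ]
  · intro S hS
    obtain ⟨g, -, rfl⟩ := Finset.mem_image.1 hS
    rcases isEmpty_or_nonempty W with hW | hW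
    · exact (Finset.card_le_one_of_subsingleton _).trans (by simp)
    have key : ∀ f : H.Copy G, f.toSubgraph = g.toSubgraph →
        ∀ w, g (Function.invFun g (f w)) = f w := by
      intro f hf w
      apply Function.invFun_eq
      have h1 : f w ∈ f.toSubgraph.verts := by simp
      rw [hf] at h1
      simpa using h1
    rw [← Fintype.card_fun, ← Finset.card_univ]
    refine Finset.card_le_card_of_injOn (fun f w => Function.invFun g (f w)) (by simp) ?_
    intro f hf f' hf' h
    simp only [Finset.coe_filter, Finset.mem_univ, true_and, Set.mem_ofPred_eq] at hf hf'
    ext w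
    rw [← key f hf w, ← key f' hf' w]
    exact congrArg g (congrFun h w)

theorem familyFree_cycleFamily_iff {V : Type*} {A : Set ℕ} {G : SimpleGraph V} :
    FamilyFree (cycleFamily A) G ↔ ∀ a ∈ A, (SimpleGraph.cycleGraph a).Free G := by
  simp [FamilyFree, cycleFamily]

theorem ex_le {W : Type*} {n B : ℕ} {H : SimpleGraph W} [Fintype W]
    {𝓕 : Set (Σ m : ℕ, SimpleGraph (Fin m))}
    (h : ∀ G : SimpleGraph (Fin n), FamilyFree 𝓕 G → G.labelledCopyCount H ≤ B) :
    ex n H 𝓕 ≤ B := by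
  classical
  unfold ex
  refine Finset.sup_le fun G hG => ?_
  rw [Finset.mem_filter] at hG
  exact SimpleGraph.copyCount_le_labelledCopyCount.trans (h G hG.2)

theorem exists_adj_cycleGraph {a : ℕ} (ha : 3 ≤ a) (i : Fin a) :
    ∃ j, (SimpleGraph.cycleGraph a).Adj i j := by
  obtain ⟨m, rfl⟩ : ∃ m, a = m + 2 := ⟨a - 2, by omega⟩
  exact ⟨i + 1, SimpleGraph.cycleGraph_adj.2 (Or.inr (by simp))⟩

theorem cycleGraph_free_map {V W : Type*} {G : SimpleGraph V} (e : V ↪ W) {a : ℕ} (ha : 3 ≤ a)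
    (h : (SimpleGraph.cycleGraph a).Free G) : (SimpleGraph.cycleGraph a).Free (G.map e) := by
  rintro ⟨f⟩
  have hf : ∀ i, ∃ x, e x = f i := by
    intro i
    obtain ⟨j, hj⟩ := exists_adj_cycleGraph ha i
    obtain ⟨u, v, -, hu, -⟩ := (SimpleGraph.map_adj _ _ _ _).1 (f.toHom.map_adj hj)
    exact ⟨u, hu⟩
  choose g hg using hf
  refine h ⟨⟨⟨g, fun {i j} hij => ?_⟩, fun i j hij => f.injective ?_⟩⟩
  · obtain ⟨u, v, huv, hu, hv⟩ := (SimpleGraph.map_adj _ _ _ _).1 (f.toHom.map_adj hij)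
    rw [e.injective ((hg i).trans hu.symm), e.injective ((hg j).trans hv.symm)]
    exact huv
  · exact (hg i).symm.trans ((congrArg e hij).trans (hg j))

theorem labelledCopyCount_le_of_copy {V V' W : Type*} [Fintype V] [Fintype V'] [Fintype W]
    {G : SimpleGraph V} {G' : SimpleGraph V'} (H : SimpleGraph W) (e : G.Copy G') :
    G.labelledCopyCount H ≤ G'.labelledCopyCount H := by
  classical
  unfold SimpleGraph.labelledCopyCount
  refine Fintype.card_le_of_injective (fun f => e.comp f) fun f g h => ?_
  ext w
  exact e.injective (DFunLike.congr_fun h w)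

/-- A graph on at most `n` vertices without cycles of length in `A` bounds `ex` from below. -/
theorem labelledCopyCount_le_mul_ex {V : Type*} [Fintype V] {A : Set ℕ} (hA : ∀ a ∈ A, 3 ≤ a)
    {n : ℕ} (hn : Fintype.card V ≤ n) (G : SimpleGraph V)
    (hG : ∀ a ∈ A, (SimpleGraph.cycleGraph a).Free G) :
    G.labelledCopyCount (SimpleGraph.cycleGraph 6) ≤
      6 ^ 6 * ex n (SimpleGraph.cycleGraph 6) (cycleFamily A) := by
  obtain ⟨e⟩ : Nonempty (V ↪ Fin n) :=
    Function.Embedding.nonempty_of_card_le (by simpa using hn)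
  refine (labelledCopyCount_le_of_copy _ (SimpleGraph.Embedding.map e G).toCopy).trans
    ((labelledCopyCount_le_mul_copyCount _ _).trans ?_)
  rw [Fintype.card_fin]
  refine Nat.mul_le_mul_left _ ?_
  unfold ex
  classical
  refine Finset.le_sup (f := fun G : SimpleGraph (Fin n) => G.copyCount (SimpleGraph.cycleGraph 6))
    (Finset.mem_filter.2 ⟨Finset.mem_univ _, familyFree_cycleFamily_iff.2 fun a ha => ?_⟩)
  exact cycleGraph_free_map e (hA a ha) (hG a ha)

theorem card_le_labelledCopyCount_of_injective {V W β : Type*} [Fintype V] [Fintype W] [Fintype β]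
    {G : SimpleGraph V} {H : SimpleGraph W} (F : β → H.Copy G) (hF : Function.Injective F) :
    Fintype.card β ≤ G.labelledCopyCount H := by
  classical
  unfold SimpleGraph.labelledCopyCount
  exact Fintype.card_le_of_injective F hF

/-- The copy of `C_6` on a closed sequence of six distinct vertices. -/
def copyOfHexagon {V : Type*} {G : SimpleGraph V} (v : Fin 6 → V)
    (hadj : ∀ i, G.Adj (v i) (v (i + 1))) (hinj : Function.Injective v) :
    (SimpleGraph.cycleGraph 6).Copy G where
  toHom := ⟨v, fun {i j} hij => by
    rcases (SimpleGraph.cycleGraph_adj (n := 4)).1 hij with h | h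
    · rw [sub_eq_iff_eq_add'.1 h]
      exact (hadj j).symm
    · rw [sub_eq_iff_eq_add'.1 h]
      exact hadj i⟩
  injective' := hinj

theorem card_le_labelledCopyCount {V β : Type*} [Fintype V] [Fintype β] {G : SimpleGraph V}
    (F : β → Fin 6 → V) (hadj : ∀ b i, G.Adj (F b i) (F b (i + 1)))
    (hinj : ∀ b, Function.Injective (F b)) (hF : Function.Injective F) :
    Fintype.card β ≤ G.labelledCopyCount (SimpleGraph.cycleGraph 6) := by
  refine card_le_labelledCopyCount_of_injective (fun b => copyOfHexagon (F b) (hadj b) (hinj b)) ?_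
  exact fun b b' h => hF (funext fun i => DFunLike.congr_fun h i)

/-- The periodic sequence of vertices of a cycle. -/
theorem exists_periodic_of_copy {V : Type*} {G : SimpleGraph V} {a : ℕ} (ha : 3 ≤ a)
    (f : (SimpleGraph.cycleGraph a).Copy G) :
    ∃ c : ℕ → V, (∀ i, G.Adj (c i) (c (i + 1))) ∧ ∀ i j, c i = c j ↔ i % a = j % a := by
  obtain ⟨m, rfl⟩ : ∃ m, a = m + 2 := ⟨a - 2, by omega⟩
  refine ⟨fun i => f (Fin.ofNat (m + 2) i), fun i => f.toHom.map_adj ?_, fun i j => ?_⟩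
  · rw [SimpleGraph.cycleGraph_adj, sub_eq_iff_eq_add' (a := Fin.ofNat (m + 2) (i + 1))]
    right
    ext
    simp [Fin.val_add]
  · rw [f.injective.eq_iff (f := f), Fin.ext_iff]
    rfl

/-- Three vertices on each side, taken alternately, are six distinct vertices. -/
theorem alternating_injective {α β : Type*} {q r s : α} {k l m : β} (qr : q ≠ r) (rs : r ≠ s)
    (sq : s ≠ q) (kl : k ≠ l) (lm : l ≠ m) (mk : m ≠ k) :
    Function.Injective
      (![.inl q, .inr k, .inl r, .inr l, .inl s, .inr m] : Fin 6 → α ⊕ β) := by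
  intro i j
  fin_cases i <;> fin_cases j <;>
    simp [qr, rs, sq, kl, lm, mk, qr.symm, rs.symm, sq.symm, kl.symm, lm.symm, mk.symm]

end Counting

/-! ### The quadratic construction. -/

section Theta

/-- Two poles joined by `m` paths of length three. -/
def theta (m : ℕ) : SimpleGraph (Bool ⊕ Fin m × Bool) where
  Adj
    | .inl _, .inl _ => False
    | .inl s, .inr q => q.2 = s
    | .inr q, .inl s => q.2 = s
    | .inr q, .inr r => q.1 = r.1 ∧ q.2 = !r.2
  symm := ⟨by rintro (s | ⟨i, s⟩) (t | ⟨j, t⟩) <;> simp +contextual⟩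
  loopless := ⟨by rintro (s | ⟨i, s⟩) <;> simp⟩

/-- A cycle cannot backtrack, so from a pole it reaches the opposite pole in three steps and returns
in six. Thus a divides 6, and a = 3 would identify the poles. -/
theorem cycleGraph_free_theta (m : ℕ) {a : ℕ} (ha : 3 ≤ a) (ha6 : a ≠ 6) :
    (SimpleGraph.cycleGraph a).Free (theta m) := by
  rintro ⟨f⟩
  obtain ⟨c, hadj, hc⟩ := exists_periodic_of_copy ha f
  have ne2 : ∀ i, c i ≠ c (i + 2) := by
    intro i h
    have h := (Nat.modEq_iff_dvd' (by omega)).1 ((hc i (i + 2)).1 h)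
    have := Nat.le_of_dvd (by omega) h
    omega
  have inner : ∀ i j s, c i = .inr (j, s) → c (i + 1) = .inl s ∨ c (i + 1) = .inr (j, !s) := by
    intro i j s h
    have h1 := hadj i
    rw [h] at h1
    rcases h2 : c (i + 1) with t | ⟨k, t⟩ <;> rw [h2] at h1 <;> simp [theta] at h1 ⊢
    · exact h1.symm
    · simp [h1]
  have pole : ∀ i s, c i = .inl s → c (i + 3) = .inl !s := by
    intro i s h
    have h1 := hadj i
    rw [h] at h1
    rcases h2 : c (i + 1) with t | ⟨k, t⟩ <;> rw [h2] at h1 <;> simp [theta] at h1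
    subst h1
    rcases inner _ _ _ h2 with h3 | h3
    · exact absurd (h.trans h3.symm) (ne2 i)
    rcases inner _ _ _ h3 with h4 | h4
    · exact h4
    · rw [Bool.not_not] at h4
      exact absurd (h2.trans h4.symm) (ne2 (i + 1))
  obtain ⟨i, s, hi⟩ : ∃ i s, c i = .inl s := by
    rcases h0 : c 0 with s | ⟨j, s⟩
    · exact ⟨0, s, h0⟩
    rcases inner _ _ _ h0 with h1 | h1
    · exact ⟨_, _, h1⟩
    rcases inner _ _ _ h1 with h2 | h2
    · exact ⟨_, _, h2⟩
    · rw [Bool.not_not] at h2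
      exact absurd (h0.trans h2.symm) (ne2 0)
  have h3 := pole i s hi
  have h6 := pole _ _ h3
  rw [Bool.not_not, ← hi, hc] at h6
  have hd : a ∣ 6 := by
    have := (Nat.modEq_iff_dvd' (by omega)).1 h6.symm
    rwa [show i + 3 + 3 - i = 6 by omega] at this
  have h33 : a = 3 := by
    have := Nat.le_of_dvd (by norm_num) hd
    interval_cases a <;> simp_all
  subst h33
  have h33 : c (i + 3) = c i := (hc _ _).2 (by simp)
  rw [h3, hi] at h33
  simp at h33

theorem descFactorial_le_labelledCopyCount_theta (m : ℕ) :
    m.descFactorial 2 ≤ (theta m).labelledCopyCount (SimpleGraph.cycleGraph 6) := by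
  have := card_le_labelledCopyCount (G := theta m) (β := Fin 2 ↪ Fin m)
    (fun e => ![.inl true, .inr (e 0, true), .inr (e 0, false), .inl false, .inr (e 1, false),
      .inr (e 1, true)]) ?_ ?_ ?_
  · simpa [Fintype.card_embedding_eq] using this
  · intro e i
    fin_cases i <;> simp [theta]
  · intro e i j
    have : e 0 ≠ e 1 := by simp
    fin_cases i <;> fin_cases j <;> simp [this, this.symm]
  · intro e e' h
    ext i
    have h1 := congrFun h 1
    have h4 := congrFun h 4
    simp at h1 h4
    fin_cases i <;> simp [h1, h4]

end Theta

/-! ### Complete bipartite constructions. -/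

section Bipartite

/-- In a bipartite graph every cycle is even and alternates between the two sides. -/
theorem even_of_copy {V : Type*} {G : SimpleGraph V} (s : V → Bool)
    (hs : ∀ u v, G.Adj u v → s v = !s u) {a : ℕ} (ha : 3 ≤ a)
    (f : (SimpleGraph.cycleGraph a).Copy G) : Even a := by
  obtain ⟨c, hadj, hc⟩ := exists_periodic_of_copy ha f
  have alt : ∀ i, s (c i) = (s (c 0) ^^ decide (i % 2 = 1)) := by
    intro i
    induction i with
    | zero => simp
    | succ i ih =>
      rw [hs _ _ (hadj i), ih]
      rcases Nat.mod_two_eq_zero_or_one i with h | h <;> simp [Nat.add_mod, h]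
  by_contra ho
  have h1 := alt a
  rw [(hc a 0).2 (by simp), Nat.odd_iff.1 (Nat.not_even_iff_odd.1 ho)] at h1
  simp at h1

theorem completeBipartiteGraph_side {α β : Type*} (u v : α ⊕ β)
    (h : (completeBipartiteGraph α β).Adj u v) : v.isLeft = !u.isLeft := by
  rcases u with u | u <;> rcases v with v | v <;> simp_all

theorem descFactorial_le_labelledCopyCount_completeBipartiteGraph (l m : ℕ) :
    l.descFactorial 3 * m.descFactorial 3 ≤
      (completeBipartiteGraph (Fin l) (Fin m)).labelledCopyCount (SimpleGraph.cycleGraph 6) := by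
  have := card_le_labelledCopyCount (G := completeBipartiteGraph (Fin l) (Fin m))
    (β := (Fin 3 ↪ Fin l) × (Fin 3 ↪ Fin m))
    (fun e => ![.inl (e.1 0), .inr (e.2 0), .inl (e.1 1), .inr (e.2 1), .inl (e.1 2),
      .inr (e.2 2)]) ?_ ?_ ?_
  · simpa [Fintype.card_embedding_eq] using this
  · intro e i
    fin_cases i <;> simp
  · exact fun e => alternating_injective (by simp) (by simp) (by simp) (by simp) (by simp)
      (by simp)
  · intro e e' h
    have h0 := congrFun h 0
    have h1 := congrFun h 1
    have h2 := congrFun h 2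
    have h3 := congrFun h 3
    have h4 := congrFun h 4
    have h5 := congrFun h 5
    simp at h0 h1 h2 h3 h4 h5
    ext i <;> fin_cases i <;> simp [h0, h1, h2, h3, h4, h5]

theorem cycleGraph_free_completeBipartiteGraph_three {β : Type*} {a : ℕ} (ha : 3 ≤ a)
    (h4 : a ≠ 4) (h6 : a ≠ 6) :
    (SimpleGraph.cycleGraph a).Free (completeBipartiteGraph (Fin 3) β) := by
  rintro ⟨f⟩
  have he := even_of_copy Sum.isLeft completeBipartiteGraph_side ha f
  obtain ⟨c, hadj, hc⟩ := exists_periodic_of_copy ha f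
  have h8 : 8 ≤ a := by
    obtain ⟨k, rfl⟩ := he
    omega
  have alt : ∀ i, (c (i + 1)).isLeft = !(c i).isLeft :=
    fun i => completeBipartiteGraph_side _ _ (hadj i)
  obtain ⟨j, hj, hl⟩ : ∃ j, j ≤ 1 ∧ (c j).isLeft = true := by
    by_cases h : (c 0).isLeft = true
    · exact ⟨0, by simp, h⟩
    · exact ⟨1, le_rfl, by rw [alt 0]; simpa using h⟩
  have hl' : ∀ i : ℕ, (c (j + 2 * i)).isLeft = true := by
    intro i
    induction i with
    | zero => exact hl
    | succ i ih => rw [show j + 2 * (i + 1) = j + 2 * i + 1 + 1 by ring, alt, alt, ih]; rfl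
  choose g hg using fun i : Fin 4 => Sum.isLeft_iff.1 (hl' i)
  have : Function.Injective g := by
    intro i i' h
    have h1 := (hc _ _).1 ((hg i).trans ((congrArg Sum.inl h).trans (hg i').symm))
    -- The four left positions are at most 7 < 8 ≤ a, so they are distinct on the cycle, but only
    -- three left vertices exist.
    rw [Nat.mod_eq_of_lt (by omega), Nat.mod_eq_of_lt (by omega)] at h1
    omega
  simpa using Fintype.card_le_of_injective g this

end Bipartite

/-! ### The C_4-free cubic construction. -/

section Incidence

variable (F : Type*) [Field F]

/-- The point-line incidence graph of the affine plane, without the vertical lines: the point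
`(x, y)` lies on the line `(m, b)` if `y = m x + b`. -/
def incidence : SimpleGraph ((F × F) ⊕ (F × F)) where
  Adj
    | .inl q, .inr l => q.2 = l.1 * q.1 + l.2
    | .inr l, .inl q => q.2 = l.1 * q.1 + l.2
    | _, _ => False
  symm := ⟨by rintro (q | q) (l | l) <;> simp⟩
  loopless := ⟨by rintro (q | q) <;> simp⟩

variable {F}

theorem incidence_side (u v : (F × F) ⊕ (F × F)) (h : (incidence F).Adj u v) :
    v.isLeft = !u.isLeft := by
  rcases u with u | u <;> rcases v with v | v <;> simp_all [incidence]

theorem point_eq_or_line_eq {q r l m : F × F} (h1 : q.2 = l.1 * q.1 + l.2)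
    (h2 : r.2 = l.1 * r.1 + l.2) (h3 : q.2 = m.1 * q.1 + m.2) (h4 : r.2 = m.1 * r.1 + m.2) :
    q = r ∨ l = m := by
  have h : (l.1 - m.1) * (q.1 - r.1) = 0 := by linear_combination -h1 + h2 + h3 - h4
  rcases mul_eq_zero.1 h with h | h
  · right
    have h := sub_eq_zero.1 h
    refine Prod.ext h ?_
    rw [h] at h1
    linear_combination h3 - h1
  · left
    have h := sub_eq_zero.1 h
    refine Prod.ext h ?_
    rw [h1, h2, h]

theorem incidence_opposite_eq {u v w x : (F × F) ⊕ (F × F)} (huv : (incidence F).Adj u v)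
    (hvw : (incidence F).Adj v w) (hwx : (incidence F).Adj w x) (hxu : (incidence F).Adj x u) :
    u = w ∨ v = x := by
  rcases u with q | l <;> rcases v with r | m <;> rcases w with s | n <;> rcases x with t | k <;>
    simp only [incidence] at huv hvw hwx hxu
  · exact (point_eq_or_line_eq huv hvw hxu hwx).imp (congrArg _) (congrArg _)
  · exact (point_eq_or_line_eq huv hxu hvw hwx).symm.imp (congrArg _) (congrArg _)

theorem cycleGraph_four_free_incidence : (SimpleGraph.cycleGraph 4).Free (incidence F) := by
  rintro ⟨f⟩
  have adj {i j : Fin 4} (hij : (SimpleGraph.cycleGraph 4).Adj i j) :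
    (incidence F).Adj (f i) (f j) := f.toHom.map_adj hij
  rcases incidence_opposite_eq (adj (i := 0) (j := 1) (by decide))
    (adj (i := 1) (j := 2) (by decide)) (adj (i := 2) (j := 3) (by decide))
    (adj (i := 3) (j := 0) (by decide)) with h | h
  · exact absurd (f.injective h) (by decide)
  · exact absurd (f.injective h) (by decide)

/-- The line through two points with distinct abscissae. -/
def lineThrough (q r : F × F) : F × F :=
  ((r.2 - q.2) / (r.1 - q.1), q.2 - (r.2 - q.2) / (r.1 - q.1) * q.1)

theorem left_on_lineThrough (q r : F × F) :
    q.2 = (lineThrough q r).1 * q.1 + (lineThrough q r).2 := by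
  simp [lineThrough]

theorem right_on_lineThrough {q r : F × F} (h : q.1 ≠ r.1) :
    r.2 = (lineThrough q r).1 * r.1 + (lineThrough q r).2 := by
  have : r.1 - q.1 ≠ 0 := sub_ne_zero.2 h.symm
  simp only [lineThrough]
  field_simp
  ring

/-- The third vertex of a triangle, at height `u` over the line through the other two. -/
def thirdPoint (q r : F × F) (x u : F) : F × F :=
  (x, (lineThrough q r).1 * x + (lineThrough q r).2 + u)

/-- Triangles give hexagons: three distinct abscissae avoid vertical sides, two ordinates are free,
and a nonzero height for the third point prevents collinearity, so the sides are distinct. -/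
theorem card_le_labelledCopyCount_incidence [Fintype F] :
    (Fintype.card F).descFactorial 3 * (Fintype.card F ^ 2 * (Fintype.card F - 1)) ≤
      (incidence F).labelledCopyCount (SimpleGraph.cycleGraph 6) := by
  classical
  have := card_le_labelledCopyCount (G := incidence F) (β := (Fin 3 ↪ F) × ((F × F) × Fˣ))
    (fun t =>
      let q : F × F := (t.1 0, t.2.1.1)
      let r : F × F := (t.1 1, t.2.1.2)
      let s := thirdPoint q r (t.1 2) t.2.2
      ![.inl q, .inr (lineThrough q r), .inl r, .inr (lineThrough r s), .inl s,
        .inr (lineThrough s q)]) ?_ ?_ ?_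
  · simpa [Fintype.card_embedding_eq, Fintype.card_units, sq] using this
  · intro t i
    have h01 : t.1 0 ≠ t.1 1 := by simp
    have h12 : t.1 1 ≠ t.1 2 := by simp
    have h20 : t.1 2 ≠ t.1 0 := by simp
    fin_cases i
    · exact left_on_lineThrough _ _
    · exact right_on_lineThrough h01
    · exact left_on_lineThrough _ _
    · exact right_on_lineThrough h12
    · exact left_on_lineThrough _ _
    · exact right_on_lineThrough h20
  · intro t
    have h01 : t.1 0 ≠ t.1 1 := by simp
    have h12 : t.1 1 ≠ t.1 2 := by simp
    have h20 : t.1 2 ≠ t.1 0 := by simp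
    set q : F × F := (t.1 0, t.2.1.1) with hq
    set r : F × F := (t.1 1, t.2.1.2) with hr
    set s := thirdPoint q r (t.1 2) t.2.2 with hs
    have qr : q ≠ r := fun h => h01 (congrArg Prod.fst h)
    have rs : r ≠ s := fun h => h12 (congrArg Prod.fst h)
    have sq : s ≠ q := fun h => h20 (congrArg Prod.fst h)
    have noncol : ∀ l : F × F, q.2 = l.1 * q.1 + l.2 → r.2 = l.1 * r.1 + l.2 →
        s.2 = l.1 * s.1 + l.2 → False := by
      intro l h1 h2 h3
      have := (point_eq_or_line_eq (left_on_lineThrough q r)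
        (right_on_lineThrough (q := q) (r := r) h01) h1 h2).resolve_left qr
      rw [← this] at h3
      simp [hs, thirdPoint] at h3
    have l1 := left_on_lineThrough q r
    have l2 := right_on_lineThrough (q := q) (r := r) h01
    have l3 := left_on_lineThrough r s
    have l4 := right_on_lineThrough (q := r) (r := s) h12
    have l5 := left_on_lineThrough s q
    have l6 := right_on_lineThrough (q := s) (r := q) h20
    have n1 : lineThrough q r ≠ lineThrough r s := fun h => noncol _ l1 l2 (h ▸ l4)
    have n2 : lineThrough r s ≠ lineThrough s q := fun h => noncol _ l6 (h ▸ l3) l5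
    have n3 : lineThrough s q ≠ lineThrough q r := fun h => noncol _ l1 l2 (h ▸ l5)
    exact alternating_injective qr rs sq n1 n2 n3
  · rintro ⟨e, ⟨y, z⟩, u⟩ ⟨e', ⟨y', z'⟩, u'⟩ h
    have h0 := congrFun h 0
    have h2 := congrFun h 2
    have h4 := congrFun h 4
    simp [thirdPoint] at h0 h2 h4
    obtain ⟨e0, rfl⟩ := h0
    obtain ⟨e1, rfl⟩ := h2
    obtain ⟨e2, h4⟩ := h4
    have he : e = e' := by
      ext i
      fin_cases i <;> simp [e0, e1, e2]
    subst he
    simpa [Units.ext_iff] using h4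

end Incidence

/-! ### Lower bounds for all large n and the final assembly. -/

section Asymptotic

theorem isTheta_pow_of_bounds {f : ℕ → ℕ} {d : ℕ} (C c N : ℕ) (hu : ∀ n, f n ≤ C * n ^ d)
    (hl : ∀ n, N ≤ n → n ^ d ≤ c * f n) :
    (fun n => (f n : ℝ)) =Θ[atTop] fun n : ℕ => (n : ℝ) ^ d := by
  constructor
  · refine IsBigO.of_bound C (Eventually.of_forall fun n => ?_)
    rw [Real.norm_of_nonneg (by positivity), Real.norm_of_nonneg (by positivity)]
    exact_mod_cast hu n
  · refine IsBigO.of_bound c ((eventually_ge_atTop N).mono fun n hn => ?_)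
    rw [Real.norm_of_nonneg (by positivity), Real.norm_of_nonneg (by positivity)]
    exact_mod_cast hl n hn

theorem labelledCopyCount_le_pow {V W : Type*} [Fintype V] [Fintype W] (G : SimpleGraph V)
    (H : SimpleGraph W) : G.labelledCopyCount H ≤ Fintype.card V ^ Fintype.card W := by
  classical
  rw [← Fintype.card_fun, ← Finset.card_univ]
  exact labelledCopyCount_le_card G _ (fun f => ⇑f) (fun _ => Finset.mem_univ _)
    DFunLike.coe_injective

variable {A : Set ℕ}

theorem sq_le_mul_ex (hA : ∀ a ∈ A, 3 ≤ a) (h6 : 6 ∉ A) {n : ℕ} (hn : 10 ≤ n) :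
    n ^ 2 ≤ 16 * 6 ^ 6 * ex n (SimpleGraph.cycleGraph 6) (cycleFamily A) := by
  obtain ⟨m, hm, hm'⟩ : ∃ m, 2 + m * 2 ≤ n ∧ n ≤ 2 * m + 3 := ⟨(n - 2) / 2, by omega, by omega⟩
  have h := labelledCopyCount_le_mul_ex hA (n := n) (by simpa using hm) (theta m)
    fun a ha => cycleGraph_free_theta m (hA a ha) (by rintro rfl; exact h6 ha)
  have h1 := (Nat.pow_sub_le_descFactorial m 2).trans (descFactorial_le_labelledCopyCount_theta m)
  obtain ⟨l, rfl⟩ : ∃ l, m = l + 1 := ⟨m - 1, by omega⟩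
  rw [show l + 1 + 1 - 2 = l by omega] at h1
  have h2 : n ^ 2 ≤ (4 * l) ^ 2 := Nat.pow_le_pow_left (by omega) 2
  nlinarith

theorem cube_le_mul_ex_of_not_mem (hA : ∀ a ∈ A, 3 ≤ a) (h4 : 4 ∉ A) (h6 : 6 ∉ A) {n : ℕ} (hn : 10 ≤ n) :
    n ^ 3 ≤ 8 * 6 ^ 6 * ex n (SimpleGraph.cycleGraph 6) (cycleFamily A) := by
  obtain ⟨l, rfl⟩ : ∃ l, n = 3 + (l + 2) := ⟨n - 5, by omega⟩
  have h := labelledCopyCount_le_mul_ex hA (n := 3 + (l + 2)) (by simp)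
    (completeBipartiteGraph (Fin 3) (Fin (l + 2)))
    fun a ha => cycleGraph_free_completeBipartiteGraph_three (hA a ha)
      (by rintro rfl; exact h4 ha) (by rintro rfl; exact h6 ha)
  have h1 := descFactorial_le_labelledCopyCount_completeBipartiteGraph 3 (l + 2)
  have h2 := Nat.pow_sub_le_descFactorial (l + 2) 3
  rw [show l + 2 + 1 - 3 = l by omega] at h2
  rw [show Nat.descFactorial 3 3 = 6 by decide] at h1
  have h3 : (3 + (l + 2)) ^ 3 ≤ (2 * l) ^ 3 := Nat.pow_le_pow_left (by omega) 3
  nlinarith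

theorem cube_le_mul_ex_of_even_eq_four (hA : ∀ a ∈ A, 3 ≤ a) (h : evenPart A = {4}) {n : ℕ} (hn : 32 ≤ n) :
    n ^ 3 ≤ 27648 * 6 ^ 6 * ex n (SimpleGraph.cycleGraph 6) (cycleFamily A) := by
  obtain ⟨m, hm, hm'⟩ : ∃ m, 8 * m ^ 2 ≤ n ∧ n < 8 * (m + 1) ^ 2 := by
    refine ⟨Nat.sqrt (n / 8), ?_, ?_⟩
    · have := Nat.sqrt_le' (n / 8)
      omega
    · have := Nat.lt_succ_sqrt' (n / 8)
      rw [Nat.succ_eq_add_one] at this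
      omega
  have hm2 : 2 ≤ m := by
    by_contra! hlt
    have : m ≤ 1 := by omega
    interval_cases m <;> omega
  -- Bertrand's postulate: p ≤ 2m fits the 2p² vertices into 8m² ≤ n, while p > m gives n < 8p².
  obtain ⟨p, hp, hmp, hpm⟩ := Nat.exists_prime_lt_and_le_two_mul m (by omega)
  have := Fact.mk hp
  have hcard : Fintype.card ((ZMod p × ZMod p) ⊕ (ZMod p × ZMod p)) ≤ n := by
    simp only [Fintype.card_sum, Fintype.card_prod, ZMod.card]
    nlinarith
  have h0 := labelledCopyCount_le_mul_ex hA hcard (incidence (ZMod p)) fun a ha => by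
    by_cases he : Even a
    · have : a ∈ evenPart A := ⟨ha, he⟩
      rw [h, Set.mem_singleton_iff] at this
      exact this ▸ cycleGraph_four_free_incidence
    · exact fun ⟨f⟩ => he (even_of_copy Sum.isLeft incidence_side (hA a ha) f)
  have h1 := card_le_labelledCopyCount_incidence (F := ZMod p)
  rw [ZMod.card] at h1
  have h2 := Nat.pow_sub_le_descFactorial p 3
  obtain ⟨l, rfl⟩ : ∃ l, p = l + 2 := ⟨p - 2, by omega⟩
  rw [show l + 2 + 1 - 3 = l by omega] at h2
  rw [show l + 2 - 1 = l + 1 by omega] at h1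
  have h3 : n ^ 3 ≤ (8 * (l + 2) ^ 2) ^ 3 :=
    Nat.pow_le_pow_left (hm'.le.trans (Nat.mul_le_mul_left _ (Nat.pow_le_pow_left hmp 2))) 3
  have h4 : (l + 2) ^ 3 ≤ (3 * l) ^ 3 := Nat.pow_le_pow_left (by omega) 3
  calc n ^ 3 ≤ (8 * (l + 2) ^ 2) ^ 3 := h3
    _ = 512 * ((l + 2) ^ 3 * ((l + 2) ^ 2 * (l + 2))) := by ring
    -- Since m ≥ 2, p ≥ 3 and l ≥ 1; this gives the constant 512 · 27 · 2 = 27648.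
    _ ≤ 512 * ((3 * l) ^ 3 * ((l + 2) ^ 2 * (2 * (l + 1)))) := by gcongr; omega
    _ = 27648 * (l ^ 3 * ((l + 2) ^ 2 * (l + 1))) := by ring
    _ ≤ 27648 * ((l + 2).descFactorial 3 * ((l + 2) ^ 2 * (l + 1))) := by gcongr
    _ ≤ 27648 * (6 ^ 6 * ex n (SimpleGraph.cycleGraph 6) (cycleFamily A)) :=
      Nat.mul_le_mul_left _ (h1.trans h0)
    _ = _ := by ring

theorem pow_six_le_mul_ex (hA : ∀ a ∈ A, 3 ≤ a) (h : evenPart A = ∅) {n : ℕ} (hn : 10 ≤ n) :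
    n ^ 6 ≤ 6 ^ 6 * 6 ^ 6 * ex n (SimpleGraph.cycleGraph 6) (cycleFamily A) := by
  obtain ⟨l, hl, hl'⟩ : ∃ l, (l + 2) + (l + 2) ≤ n ∧ n ≤ 6 * l :=
    ⟨n / 2 - 2, by omega, by omega⟩
  have h0 := labelledCopyCount_le_mul_ex hA (n := n) (by simpa using hl)
    (completeBipartiteGraph (Fin (l + 2)) (Fin (l + 2))) fun a ha ⟨f⟩ => by
      have : a ∈ evenPart A :=
        ⟨ha, even_of_copy Sum.isLeft completeBipartiteGraph_side (hA a ha) f⟩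
      simp [h] at this
  have h1 := descFactorial_le_labelledCopyCount_completeBipartiteGraph (l + 2) (l + 2)
  have h2 := Nat.pow_sub_le_descFactorial (l + 2) 3
  rw [show l + 2 + 1 - 3 = l by omega] at h2
  calc n ^ 6 ≤ (6 * l) ^ 6 := Nat.pow_le_pow_left hl' 6
    _ = 6 ^ 6 * (l ^ 3 * l ^ 3) := by ring
    _ ≤ 6 ^ 6 * ((l + 2).descFactorial 3 * (l + 2).descFactorial 3) := by gcongr
    _ ≤ 6 ^ 6 * (6 ^ 6 * ex n (SimpleGraph.cycleGraph 6) (cycleFamily A)) :=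
      Nat.mul_le_mul_left _ (h1.trans h0)
    _ = _ := by ring

theorem ex_eq_zero (h6 : 6 ∈ A) (n : ℕ) :
    ex n (SimpleGraph.cycleGraph 6) (cycleFamily A) = 0 := by
  refine Nat.le_zero.1 (ex_le fun G hG => ?_)
  exact (SimpleGraph.labelledCopyCount_eq_zero.2 (familyFree_cycleFamily_iff.1 hG 6 h6)).le

end Asymptotic

end GenTuran

open GenTuran

theorem theorem2p10 (A : Set ℕ) (hA : ∀ a ∈ A, 3 ≤ a) :
    (6 ∈ A → ∀ n : ℕ, GenTuran.ex n (SimpleGraph.cycleGraph 6) (GenTuran.cycleFamily A) = 0) ∧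
    (6 ∉ A → 4 ∈ A → 2 ≤ (GenTuran.evenPart A).encard →
      (fun n : ℕ => (GenTuran.ex n (SimpleGraph.cycleGraph 6) (GenTuran.cycleFamily A) : ℝ))
        =Θ[atTop] fun n : ℕ => (n : ℝ) ^ 2) ∧
    ((4 ∉ A ∧ 6 ∉ A ∧ (GenTuran.evenPart A).Nonempty) ∨ GenTuran.evenPart A = {4} →
      (fun n : ℕ => (GenTuran.ex n (SimpleGraph.cycleGraph 6) (GenTuran.cycleFamily A) : ℝ))
        =Θ[atTop] fun n : ℕ => (n : ℝ) ^ 3) ∧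
    (GenTuran.evenPart A = ∅ →
      (fun n : ℕ => (GenTuran.ex n (SimpleGraph.cycleGraph 6) (GenTuran.cycleFamily A) : ℝ))
        =Θ[atTop] fun n : ℕ => (n : ℝ) ^ 6) := by
  have half : ∀ a ∈ evenPart A, ∃ k, a = 2 * k ∧ 2 ≤ k := by
    rintro a ⟨ha, k, rfl⟩
    have := hA _ ha
    exact ⟨k, by ring, by omega⟩
  have free : ∀ {n : ℕ} {G : SimpleGraph (Fin n)}, FamilyFree (cycleFamily A) G →
      ∀ {a}, a ∈ A → (SimpleGraph.cycleGraph a).Free G :=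
    fun hG _ ha => familyFree_cycleFamily_iff.1 hG _ ha
  refine ⟨ex_eq_zero, fun h6 h4 h2 => ?_, fun h => ?_, fun h => ?_⟩
  · obtain ⟨a, ha, ha4⟩ : ∃ a ∈ evenPart A, a ≠ 4 := by
      by_contra! hc
      have := (Set.encard_le_encard (show evenPart A ⊆ {4} from hc)).trans_eq
        (Set.encard_singleton 4)
      exact absurd (h2.trans this) (by norm_num)
    obtain ⟨k, rfl, hk⟩ := half a ha
    refine isTheta_pow_of_bounds (136 * k ^ 2) (16 * 6 ^ 6) 10
      (fun n => ex_le fun G hG => ?_) fun n => sq_le_mul_ex hA h6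
    simpa using labelledCopyCount_cycleGraph_six_le_sq (free hG h4) (k := k) (by omega)
      (free hG ha.1)
  · obtain ⟨a, ha⟩ : (evenPart A).Nonempty := by
      rcases h with h | h
      · exact h.2.2
      · simp [h]
    obtain ⟨k, rfl, hk⟩ := half a ha
    -- The lower constant and threshold are the larger of those for the two constructions.
    refine isTheta_pow_of_bounds ((128 * k ^ 2) ^ 2) (27648 * 6 ^ 6) 32
      (fun n => ex_le fun G hG => ?_) fun n hn => ?_
    · simpa using labelledCopyCount_cycleGraph_six_le_cube G hk (free hG ha.1)
    · rcases h with h | h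
      · exact (cube_le_mul_ex_of_not_mem hA h.1 h.2.1 (by omega)).trans (by gcongr; norm_num)
      · exact cube_le_mul_ex_of_even_eq_four hA h hn
  · refine isTheta_pow_of_bounds 1 (6 ^ 6 * 6 ^ 6) 10 (fun n => ex_le fun G _ => ?_)
      fun n => pow_six_le_mul_ex hA h
    simpa using labelledCopyCount_le_pow G (SimpleGraph.cycleGraph 6)
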